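/- For integers $v\ge 1$ and $0\le e\le\binom v2$, let $\max(v,e)$ be the maximum of $\sum_{i=1}^v d_i^2$ over all simple graphs with $v$ vertices and $e$ edges, where $d_1,\dots,d_v$ are the degrees of the vertices. The quasi-complete graph $\mathrm{QC}(v,e)$ is defined as follows: let $k,j$ be the unique integers with $e=\binom{k+1}{2}-j$ and $1\le j\le k$; on the vertex set $\{1,\dots,v\}$ the vertices $1,\dots,k$ are pairwise adjacent, the vertex $k+1$ is adjacent to $1,\dots,k-j$ (no edge being added here if $j=k$), and there are no other edges. The quasi-star graph $\mathrm{QS}(v,e)$ is the complement of $\mathrm{QC}\left(v,\binom v2-e\right)$, and $S(v,e)$ denotes the sum of the squares of its degrees. Put $m=m(v)=\frac12\binom v2$. For a positive integer $t$ let $n(t)$ be the number of integers $v$ in $[1,t]$ such that $\max(v,e)=S(v,e)$ for all integers $e$ with $0\le e\le m(v)$. Then $$\lim_{t\to\infty}\frac{n(t)}{t}=2-\sqrt2 .$$ -/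

import Mathlib

namespace DegreeSquares

/-- `P₂(G)`, the sum of the squares of the degrees of a graph on `v` vertices. -/
noncomputable def P2 {v : ℕ} (G : SimpleGraph (Fin v)) : ℕ :=
  open scoped Classical in ∑ x : Fin v, G.degree x ^ 2

/-- `max(v,e)`, the largest value of `P₂(G)` over all simple graphs `G` with `v` vertices and
`e` edges (there is at least one such graph exactly when `e ≤ v.choose 2`). -/
noncomputable def maxP2 (v e : ℕ) : ℕ :=
  open scoped Classical in
    (Finset.univ.filter fun G : SimpleGraph (Fin v) => G.edgeFinset.card = e).sup P2

/-- The integer `k` in the unique representation `e = (k+1 choose 2) - j`, `1 ≤ j ≤ k`: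
the largest `k` with `k choose 2 ≤ e`. -/
def qcK (e : ℕ) : ℕ := Nat.findGreatest (fun k => k.choose 2 ≤ e) (e + 1)

/-- The integer `j` in the unique representation `e = (k+1 choose 2) - j`, `1 ≤ j ≤ k`. -/
def qcJ (e : ℕ) : ℕ := (qcK e + 1).choose 2 - e

/-- The pair `(qcK e, qcJ e)` is the unique pair `(k, j)` with `e = (k+1 choose 2) - j` and
`1 ≤ j ≤ k`. -/
theorem qc_representation (e k j : ℕ) :
    (e + j = (k + 1).choose 2 ∧ 1 ≤ j ∧ j ≤ k) ↔ (k = qcK e ∧ j = qcJ e) := by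
  have step : ∀ n : ℕ, (n + 1).choose 2 = n + n.choose 2 := fun n => by
    rw [Nat.choose_succ_succ' n 1, Nat.choose_one_right]
  have le_choose : ∀ n : ℕ, n ≤ (n + 1).choose 2 := fun n => by rw [step]; omega
  have h1 : 1 ≤ qcK e := Nat.le_findGreatest (by omega) (by simp)
  have h2 : (qcK e).choose 2 ≤ e :=
    Nat.findGreatest_spec (P := fun k => k.choose 2 ≤ e) (m := 1) (by omega) (by simp)
  have h3 : e < (qcK e + 1).choose 2 := by
    by_contra! h
    have hb : qcK e + 1 ≤ e + 1 := by
      have := le_choose (qcK e)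
      omega
    have : qcK e + 1 ≤ qcK e := Nat.le_findGreatest hb h
    omega
  constructor
  · rintro ⟨he, hj1, hjk⟩
    have hs := step k
    have hk : k = qcK e := by
      rcases lt_trichotomy k (qcK e) with h | h | h
      · have := Nat.choose_le_choose 2 (show k + 1 ≤ qcK e from h)
        omega
      · exact h
      · have := Nat.choose_le_choose 2 (show qcK e + 1 ≤ k from h)
        omega
    refine ⟨hk, ?_⟩
    subst hk
    unfold qcJ
    omega
  · rintro ⟨rfl, rfl⟩
    have hs := step (qcK e)
    unfold qcJ
    omega

/-- The quasi-complete graph `QC(v,e)`, for `0 ≤ e ≤ v.choose 2`: with `e = (k+1 choose 2) - j`,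
`1 ≤ j ≤ k`, the first `k` vertices `0, …, k-1` form a complete graph, the vertex `k` is joined
to the `k - j` vertices `0, …, k-j-1`, and there are no other edges. -/
def QC (v e : ℕ) : SimpleGraph (Fin v) where
  Adj a b := a ≠ b ∧
    ((a.val < qcK e ∧ b.val < qcK e) ∨
      (a.val < qcK e - qcJ e ∧ b.val = qcK e) ∨
      (b.val < qcK e - qcJ e ∧ a.val = qcK e))
  symm := ⟨fun a b h => by tauto⟩
  loopless := ⟨fun a h => h.1 rfl⟩

/-- The quasi-star graph `QS(v,e)`, for `0 ≤ e ≤ v.choose 2`: the complement of `QC(v,e')` with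
`e' = v.choose 2 - e`. -/
def QS (v e : ℕ) : SimpleGraph (Fin v) := (QC v (v.choose 2 - e))ᶜ

/-- `S(v,e)`, the sum of the squares of the degrees of the quasi-star graph. -/
noncomputable def S (v e : ℕ) : ℕ := P2 (QS v e)

/-- `m(v)`, half of `v choose 2` (not necessarily an integer). -/
def m (v : ℕ) : ℚ := (v.choose 2 : ℚ) / 2

/-- `n(t)`, the number of integers `v` in `[1,t]` such that `max(v,e) = S(v,e)` for all integers
`e` with `0 ≤ e ≤ m(v)`. -/
noncomputable def n (t : ℕ) : ℕ :=
  {v : ℕ | v ∈ Set.Icc 1 t ∧ ∀ e : ℕ, (e : ℚ) ≤ m v → maxP2 v e = S v e}.ncard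

end DegreeSquares

/-!
The maximum of `P₂` is always attained at the quasi-star or at the quasi-complete graph
(`degSq_le_max`), so everything reduces to comparing two explicit functions of `e`.

*Ahlswede–Katona.* Replacing an edge `yz` by a new edge `xz`, where `deg x ≥ deg y`, increases
`P₂`; hence a maximizer has a dominating or an isolated vertex (`exists_dominating_or_isolated`),
and one inducts on the number of vertices. A dominating vertex added to a quasi-star graph gives a
quasi-star graph;
added to a quasi-complete graph with a large clique, it gives at most the value of the
quasi-complete graph (`qcSum_add_dominating_le`), and if the clique is small, the quasi-star graph
was already at least as good (`qcSum_le_qsSum_of_clique_small`). Isolated vertices are dual.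

*Comparison.* Write `P₂` of a quasi-complete graph as a polynomial in the clique size `k` and in
`e`, quadratic in `e` for fixed `k`. Among all clique sizes the true one minimizes this polynomial
(`cliqueSum_le`), and in the difference of the quasi-star and the quasi-complete value the squares
of `e` cancel. The difference is therefore piecewise linear, and it vanishes at half of all edges;
to see that it is nonnegative up to there, it suffices to look at the numbers `e = k.choose 2`. It
is nonnegative there for `k < halfClique v`, where `halfClique v` is the largest admissible `k`, and
for `k = halfClique v` it is, in the relevant case, an explicit product
(`qsSum_sub_qcSum_halfClique`).

*Density.* The sign of that product says that, up to the sparse set of solutions of a Pell equation,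
`v + 2` is counted exactly when `halfClique (v + 2) = halfClique v + 1`; the only other possibility
is `halfClique v + 2` (`qcSum_le_qsSum_halfClique_iff`). Telescoping gives
`n t = 2 * t - halfClique t - halfClique (t - 1) + O(log t)`, and `halfClique t` is `t / √2` up to a
bounded error.
-/

namespace DegreeSquares

/-! ### Values of the two extremal graphs as functions of the number of edges -/

theorem one_le_qcK (e : ℕ) : 1 ≤ qcK e := by
  have := (qc_representation e _ _).2 ⟨rfl, rfl⟩
  omega

theorem cast_choose_two (k : ℕ) : ((k.choose 2 : ℕ) : ℚ) = k * (k - 1) / 2 :=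
  Nat.cast_choose_two ℚ k

theorem choose_two_succ (k : ℕ) : (k + 1).choose 2 = k.choose 2 + k := by
  rw [Nat.choose_succ_succ' k 1, Nat.choose_one_right, add_comm]

theorem choose_qcK_le (e : ℕ) : (qcK e).choose 2 ≤ e := by
  have := (qc_representation e _ _).2 ⟨rfl, rfl⟩
  have := choose_two_succ (qcK e)
  omega

theorem lt_choose_qcK_succ (e : ℕ) : e < (qcK e + 1).choose 2 := by
  have := (qc_representation e _ _).2 ⟨rfl, rfl⟩
  omega

theorem le_qcK {e k : ℕ} (h : k.choose 2 ≤ e) : k ≤ qcK e := by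
  by_contra! hk
  have := Nat.choose_le_choose 2 (show qcK e + 1 ≤ k from hk)
  have := lt_choose_qcK_succ e
  omega

theorem qcK_le {e k : ℕ} (h : e < (k + 1).choose 2) : qcK e ≤ k := by
  by_contra! hk
  have := Nat.choose_le_choose 2 (show k + 1 ≤ qcK e from hk)
  have := choose_qcK_le e
  omega

theorem qcK_choose {k : ℕ} (hk : 1 ≤ k) : qcK (k.choose 2) = k :=
  le_antisymm (qcK_le (by rw [choose_two_succ]; omega)) (le_qcK le_rfl)

/-- The sum of the squares of the degrees of a `k`-clique together with one further vertex joined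
to `e - k.choose 2` vertices of the clique, as a polynomial in `k` and `e`; it makes sense for all
rational `e`. -/
def cliqueSum (k e : ℚ) : ℚ :=
  k * (k - 1) ^ 2 + (e - k * (k - 1) / 2) * (2 * k - 1) + (e - k * (k - 1) / 2) ^ 2

/-- The sum of the squares of the degrees of the quasi-complete graph with `e` edges, which does not
depend on the number of vertices; see `P2_QC`. -/
def qcSum (e : ℕ) : ℚ := cliqueSum (qcK e) e

/-- The sum of the squares of the degrees of the quasi-star graph with `v` vertices and `e` edges,
written through the complement; see `S_eq_qsSum`. It is meaningful only for `e ≤ v.choose 2`. -/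
def qsSum (v e : ℕ) : ℚ :=
  v * (v - 1) ^ 2 - 4 * (v - 1) * (v.choose 2 - e) + qcSum (v.choose 2 - e)

theorem cliqueSum_succ (k e : ℚ) :
    cliqueSum (k + 1) e = cliqueSum k e + 2 * (k - 1) * ((k + 1) * k / 2 - e) := by
  unfold cliqueSum; ring

/-- For a fixed number of edges, `cliqueSum` is smallest at the clique size of the quasi-complete
graph, since by `cliqueSum_succ` its increment at `k` has the sign of `(k + 1).choose 2 - e`. The
number of edges may be rational because half of all edges need not be an integer. -/
theorem cliqueSum_le {k l : ℕ} {e : ℚ} (hk : 1 ≤ k) (hl : 1 ≤ l)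
    (h1 : (k : ℚ) * (k - 1) / 2 ≤ e) (h2 : e ≤ (k + 1 : ℚ) * k / 2) :
    cliqueSum k e ≤ cliqueSum l e := by
  rcases le_total k l with h | h
  · induction l, h using Nat.le_induction with
    | base => exact le_rfl
    | succ l hkl ih =>
      refine (ih (by omega)).trans ?_
      push_cast
      rw [cliqueSum_succ]
      have a : (1 : ℚ) ≤ l := by exact_mod_cast hk.trans hkl
      have b : (k : ℚ) ≤ l := by exact_mod_cast hkl
      have c : (0 : ℚ) ≤ k := by positivity
      have : (0 : ℚ) ≤ 2 * (l - 1) * ((l + 1) * l / 2 - e) :=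
        mul_nonneg (by linarith) (by nlinarith)
      linarith
  · obtain ⟨d, rfl⟩ := Nat.exists_eq_add_of_le h
    clear h
    induction d generalizing l with
    | zero => exact le_rfl
    | succ d ih =>
      have e1 : l + (d + 1) = l + 1 + d := by ring
      rw [e1] at hk h1 h2 ⊢
      refine (ih (l := l + 1) (by omega) hk h1 h2).trans ?_
      push_cast at h1 ⊢
      rw [cliqueSum_succ]
      have a : (1 : ℚ) ≤ l := by exact_mod_cast hl
      have c : (0 : ℚ) ≤ d := by positivity
      have : 0 ≤ 2 * ((l : ℚ) - 1) * (e - (l + 1) * l / 2) :=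
        mul_nonneg (by linarith) (by nlinarith)
      linarith

theorem qcSum_le_cliqueSum (e : ℕ) {l : ℕ} (hl : 1 ≤ l) : qcSum e ≤ cliqueSum l e := by
  have h1 : ((qcK e).choose 2 : ℚ) ≤ e := by exact_mod_cast choose_qcK_le e
  have h2 : (e : ℚ) ≤ ((qcK e + 1).choose 2 : ℕ) := by exact_mod_cast (lt_choose_qcK_succ e).le
  rw [cast_choose_two] at h1 h2
  refine cliqueSum_le (one_le_qcK e) hl h1 ?_
  push_cast at h2
  linarith

theorem qcSum_choose {k : ℕ} (hk : 1 ≤ k) : qcSum (k.choose 2) = k * (k - 1) ^ 2 := by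
  rw [qcSum, qcK_choose hk, cliqueSum, cast_choose_two]; ring

/-- Adding a dominating vertex to a quasi-complete graph on `a` vertices whose clique has at least
`(a - 1) / 2` vertices yields at most the value of the quasi-complete graph with the same number of
edges. -/
theorem qcSum_add_dominating_le {a E : ℕ} (hE : E ≤ a.choose 2) (ha : a ≤ 2 * qcK E + 1) :
    qcSum E + 4 * E + a * (a + 1) ≤ qcSum (E + a) := by
  set k := qcK E with hk
  have h1 := choose_qcK_le E
  have h2 := lt_choose_qcK_succ E
  rw [← hk] at h1 h2
  have k1 : 1 ≤ k := one_le_qcK E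
  rcases Nat.eq_zero_or_pos a with rfl | apos
  · have : E = 0 := by simpa using hE
    subst this; simp
  have hka : k ≤ a := by
    by_contra! h
    have := Nat.choose_le_choose 2 (show a + 1 ≤ k from h)
    have := choose_two_succ a
    omega
  have s1 := choose_two_succ k
  have s2 : (k + 2).choose 2 = _ := choose_two_succ (k + 1)
  have s3 : (k + 2 + 1).choose 2 = _ := choose_two_succ (k + 2)
  have l1 : k + 1 ≤ qcK (E + a) := le_qcK (by omega)
  have l2 : qcK (E + a) ≤ k + 2 := qcK_le (by omega)
  have q1 : (k : ℚ) * (k - 1) / 2 ≤ E := by rw [← cast_choose_two]; exact_mod_cast h1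
  have q2 : (E : ℚ) ≤ k * (k - 1) / 2 + k := by
    rw [← cast_choose_two]; exact_mod_cast (by omega : E ≤ k.choose 2 + k)
  rw [qcSum, qcSum, ← hk]
  -- The clique gains one or two vertices, and the gain of `P₂` is a product in both cases.
  have hc : qcK (E + a) = k + 1 ∨ qcK (E + a) = k + 2 := by omega
  rcases hc with h | h <;> rw [h]
  · have key : cliqueSum ((k + 1 : ℕ) : ℚ) ((E + a : ℕ) : ℚ) - (cliqueSum k E + 4 * E + a * (a + 1))
        = 2 * (E - k * (k - 1) / 2) * (a - k - 1) := by
      unfold cliqueSum; push_cast; ring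
    have : (0 : ℚ) ≤ 2 * (E - k * (k - 1) / 2) * (a - k - 1) := by
      rcases hka.eq_or_lt with rfl | hlt
      · have : (E : ℚ) = k * (k - 1) / 2 := by
          rw [← cast_choose_two]; exact_mod_cast le_antisymm hE h1
        rw [this]; simp
      · have : (k : ℚ) + 1 ≤ a := by exact_mod_cast hlt
        exact mul_nonneg (by linarith) (by linarith)
    linarith
  · have key : cliqueSum ((k + 2 : ℕ) : ℚ) ((E + a : ℕ) : ℚ) - (cliqueSum k E + 4 * E + a * (a + 1))
        = 2 * (2 * k + 1 - a) * (k * (k - 1) / 2 + k - E) := by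
      unfold cliqueSum; push_cast; ring
    have haq : (a : ℚ) ≤ 2 * k + 1 := by exact_mod_cast ha
    have : (0 : ℚ) ≤ 2 * (2 * k + 1 - a) * (k * (k - 1) / 2 + k - E) :=
      mul_nonneg (by linarith) (by linarith)
    linarith

theorem qsSum_succ_add (v e : ℕ) :
    qsSum (v + 1) (e + v) = qsSum v e + 4 * e + v * (v + 1) := by
  have : (v + 1).choose 2 - (e + v) = v.choose 2 - e := by rw [choose_two_succ]; omega
  rw [qsSum, qsSum, this, cast_choose_two, cast_choose_two]
  push_cast; ring

theorem qsSum_le_succ {v e : ℕ} (he : e ≤ v.choose 2) (h : v ≤ 2 * qcK (v.choose 2 - e) + 1) :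
    qsSum v e ≤ qsSum (v + 1) e := by
  have key := qcSum_add_dominating_le (Nat.sub_le (v.choose 2) e) h
  have e1 : (v + 1).choose 2 - e = v.choose 2 - e + v := by rw [choose_two_succ]; omega
  rw [Nat.cast_sub he] at key
  rw [qsSum, qsSum, e1]
  rw [cast_choose_two] at *
  rw [cast_choose_two]
  push_cast
  linarith

/-- Passing to complements exchanges the two extremal graphs. -/
theorem qsSum_compl {v e : ℕ} (he : e ≤ v.choose 2) (h : qcSum (v.choose 2 - e) ≤
    qsSum v (v.choose 2 - e)) : qsSum v e ≤ qcSum e := by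
  rw [qsSum, Nat.sub_sub_self he, Nat.cast_sub he] at h
  rw [qsSum]
  rw [cast_choose_two] at *
  linarith

theorem sub_one_mul_self_nonneg (z : ℤ) : (0 : ℚ) ≤ (z - 1) * z := by
  have : 0 ≤ (z - 1) * z := by
    rcases le_or_gt z 0 with h | h <;> nlinarith
  exact_mod_cast this

/-- The base inequality for the comparison at a complete graph `K_k`: when the complement has at
least `(k + 1).choose 2` edges, the quasi-star graph is at least as good. The proof decreases `v`
until the clique of the complement has `k + 1` or `k + 2` vertices. -/
theorem qcSum_choose_le_qsSum {v k : ℕ} (hk : 1 ≤ k)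
    (h : k.choose 2 + (k + 1).choose 2 ≤ v.choose 2) :
    qcSum (k.choose 2) ≤ qsSum v (k.choose 2) := by
  induction v with
  | zero =>
    have := choose_two_succ k
    simp at h; omega
  | succ v ih =>
    have s0 := choose_two_succ v
    have s1 := choose_two_succ k
    have s2 : (k + 2).choose 2 = _ := choose_two_succ (k + 1)
    have s3 : (k + 2 + 1).choose 2 = _ := choose_two_succ (k + 2)
    by_cases hE : k.choose 2 + (k + 1).choose 2 ≤ v.choose 2
    · refine (ih hE).trans (qsSum_le_succ (by omega) ?_)
      -- The complement has at least half of the edges, so its clique has about `v / √2` vertices.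
      by_contra! hv
      have a1 := lt_choose_qcK_succ (v.choose 2 - k.choose 2)
      set l := qcK (v.choose 2 - k.choose 2)
      have a2 : v.choose 2 < 2 * (l + 1).choose 2 := by omega
      have a3 := Nat.choose_le_choose 2 (show 2 * l + 2 ≤ v from hv)
      have a4 : (2 * l + 2).choose 2 < 2 * (l + 1).choose 2 := by omega
      have a5 : (((2 * l + 2).choose 2 : ℕ) : ℚ) < 2 * ((l + 1).choose 2 : ℕ) := by
        exact_mod_cast a4
      rw [cast_choose_two, cast_choose_two] at a5
      push_cast at a5
      have : (0 : ℚ) ≤ l := by positivity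
      nlinarith
    · set E := (v + 1).choose 2 - k.choose 2 with hEdef
      have hEq : (E : ℚ) = (v + 1) * v / 2 - k * (k - 1) / 2 := by
        rw [hEdef, Nat.cast_sub (by omega), cast_choose_two, cast_choose_two]; push_cast; ring
      have l1 : k + 1 ≤ qcK E := le_qcK (by omega)
      rw [qcSum_choose hk, qsSum, ← hEdef, qcSum]
      rcases l1.eq_or_lt with l1 | l1
      -- For a clique of `k + 1` vertices the difference is a product of consecutive integers.
      · rw [← l1]
        have key : ((v + 1 : ℕ) : ℚ) * (((v + 1 : ℕ) : ℚ) - 1) ^ 2 - 4 * (((v + 1 : ℕ) : ℚ) - 1) *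
            (((v + 1).choose 2 : ℕ) - (k.choose 2 : ℕ)) + cliqueSum ((k + 1 : ℕ) : ℚ) E
            - k * (k - 1) ^ 2 =
            (E - k * (k - 1) / 2 - (v + 1)) * (E - k * (k - 1) / 2 - v) := by
          rw [cast_choose_two, cast_choose_two, hEq]; unfold cliqueSum; push_cast; ring
        have : 0 ≤ ((E : ℚ) - k * (k - 1) / 2 - (v + 1)) * (E - k * (k - 1) / 2 - v) := by
          obtain ⟨z, hz⟩ : ∃ z : ℤ, (z : ℚ) = E - k * (k - 1) / 2 - v :=
            ⟨E - k.choose 2 - v, by rw [← cast_choose_two]; push_cast; ring⟩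
          have : (E : ℚ) - k * (k - 1) / 2 - (v + 1) = z - 1 := by linear_combination -hz
          rw [this, ← hz]
          exact sub_one_mul_self_nonneg z
        rw [← sub_nonneg, key]
        exact this
      -- Otherwise, as `v` vertices fall short of the assumption, the clique has `k + 2` vertices
      -- and `v` is close to `√2 * k`, hence at most `(3 * k + 1) / 2`.
      · have c1 : (k + 2).choose 2 ≤ E := (Nat.choose_le_choose 2 l1).trans (choose_qcK_le E)
        have c2 : E < (k + 1).choose 2 + v := by omega
        have k3 : (v : ℚ) * (v - 1) < 2 * k ^ 2 := by
          have : ((v.choose 2 : ℕ) : ℚ) < (k.choose 2 : ℕ) + ((k + 1).choose 2 : ℕ) := by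
            exact_mod_cast not_le.1 hE
          rw [cast_choose_two, cast_choose_two, cast_choose_two] at this
          push_cast at this
          linarith
        have hv2 : 2 * v ≤ 3 * k + 1 := by
          by_contra! hv
          have : (3 * k + 2 : ℚ) ≤ 2 * v := by exact_mod_cast hv
          have : (0 : ℚ) ≤ k := by positivity
          nlinarith
        have l2 : qcK E = k + 2 := le_antisymm (qcK_le (by omega)) l1
        rw [l2]
        have key : ((v + 1 : ℕ) : ℚ) * (((v + 1 : ℕ) : ℚ) - 1) ^ 2 - 4 * (((v + 1 : ℕ) : ℚ) - 1) *
            (((v + 1).choose 2 : ℕ) - (k.choose 2 : ℕ)) + cliqueSum ((k + 2 : ℕ) : ℚ) E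
            - k * (k - 1) ^ 2 =
            (E - k * (k - 1) / 2 - (v + 1) - k) * (E - k * (k - 1) / 2 - v - k)
              + k * (3 * k + 1 - 2 * v) := by
          rw [cast_choose_two, cast_choose_two, hEq]; unfold cliqueSum; push_cast; ring
        have : 0 ≤ ((E : ℚ) - k * (k - 1) / 2 - (v + 1) - k) * (E - k * (k - 1) / 2 - v - k) := by
          obtain ⟨z, hz⟩ : ∃ z : ℤ, (z : ℚ) = E - k * (k - 1) / 2 - v - k :=
            ⟨E - k.choose 2 - v - k, by rw [← cast_choose_two]; push_cast; ring⟩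
          have : (E : ℚ) - k * (k - 1) / 2 - (v + 1) - k = z - 1 := by linear_combination -hz
          rw [this, ← hz]
          exact sub_one_mul_self_nonneg z
        have hv2' : 0 ≤ (k : ℚ) * (3 * k + 1 - 2 * v) := by
          have : (2 * v : ℚ) ≤ 3 * k + 1 := by exact_mod_cast hv2
          exact mul_nonneg (by positivity) (by linarith)
        rw [← sub_nonneg, key]
        exact add_nonneg this hv2'

/-! ### Comparison of the quasi-star and the quasi-complete graph -/

/-- The difference between the values of the quasi-star and the quasi-complete graph with `e` edges,
as long as the cliques of the quasi-complete graphs with `e` and `v.choose 2 - e` edges have `k` and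
`l` vertices. The squares of `e` cancel, so that this is an affine function of `e`. -/
def gapPoly (v k l e : ℚ) : ℚ :=
  v * (v - 1) ^ 2 - 4 * (v - 1) * (v * (v - 1) / 2 - e) + cliqueSum l (v * (v - 1) / 2 - e)
    - cliqueSum k e

theorem gapPoly_affine (v k l a b e : ℚ) :
    (b - a) * gapPoly v k l e = (b - e) * gapPoly v k l a + (e - a) * gapPoly v k l b := by
  unfold gapPoly cliqueSum; ring

theorem gapPoly_nonneg_of_endpoints {v k l a b e : ℚ} (hae : a ≤ e) (heb : e ≤ b)
    (ha : 0 ≤ gapPoly v k l a) (hb : 0 ≤ gapPoly v k l b) : 0 ≤ gapPoly v k l e := by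
  rcases (hae.trans heb).eq_or_lt with h | h
  · rwa [le_antisymm (h ▸ heb) hae]
  · have h1 := gapPoly_affine v k l a b e
    have h2 : 0 ≤ (b - a) * gapPoly v k l e := by
      rw [h1]
      exact add_nonneg (mul_nonneg (by linarith) ha) (mul_nonneg (by linarith) hb)
    exact nonneg_of_mul_nonneg_right h2 (by linarith)

theorem qsSum_sub_qcSum {v e : ℕ} (he : e ≤ v.choose 2) :
    qsSum v e - qcSum e = gapPoly v (qcK e) (qcK (v.choose 2 - e)) e := by
  rw [qsSum, qcSum, qcSum, gapPoly, Nat.cast_sub he, cast_choose_two]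

/-- At a complete graph `K_k`, the difference of the two extremal values is bounded above by
`gapPoly` with any second clique size. -/
theorem qsSum_sub_qcSum_choose_le {v k l : ℕ} (hk : 1 ≤ k) (hl : 1 ≤ l)
    (h : k.choose 2 ≤ v.choose 2) :
    qsSum v (k.choose 2) - qcSum (k.choose 2) ≤ gapPoly v k l (k.choose 2 : ℕ) := by
  have := qcSum_le_cliqueSum (v.choose 2 - k.choose 2) hl
  rw [Nat.cast_sub h] at this
  have e : qcSum (k.choose 2) = cliqueSum k (k.choose 2 : ℕ) := by rw [qcSum, qcK_choose hk]
  rw [qsSum, gapPoly, e]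
  rw [cast_choose_two v] at *
  linarith

theorem gapPoly_succ_left (v k l : ℚ) :
    gapPoly v (k + 1) l ((k + 1) * k / 2) = gapPoly v k l ((k + 1) * k / 2) := by
  rw [gapPoly, gapPoly, cliqueSum_succ]; ring

theorem qcSum_le_qsSum_of_endpoints {v e : ℕ} (h : (qcK e + 1).choose 2 ≤ v.choose 2)
    (h0 : qcSum ((qcK e).choose 2) ≤ qsSum v ((qcK e).choose 2))
    (h1 : qcSum ((qcK e + 1).choose 2) ≤ qsSum v ((qcK e + 1).choose 2)) :
    qcSum e ≤ qsSum v e := by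
  have a1 := choose_qcK_le e
  have a2 := lt_choose_qcK_succ e
  rw [← sub_nonneg, qsSum_sub_qcSum (by omega)]
  set k := qcK e with hk
  have k1 : 1 ≤ k := one_le_qcK e
  have l1 := one_le_qcK (v.choose 2 - e)
  refine gapPoly_nonneg_of_endpoints (a := (k.choose 2 : ℕ)) (b := ((k + 1).choose 2 : ℕ))
    (by exact_mod_cast a1) (by exact_mod_cast a2.le)
    ((sub_nonneg.2 h0).trans (qsSum_sub_qcSum_choose_le k1 l1 (by omega))) ?_
  have h2 := (sub_nonneg.2 h1).trans (qsSum_sub_qcSum_choose_le (by omega) l1 h)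
  have h3 := gapPoly_succ_left v k (qcK (v.choose 2 - e))
  rw [cast_choose_two] at h2 ⊢
  push_cast at h2 ⊢
  rw [add_sub_cancel_right] at *
  rwa [h3] at h2

theorem qcSum_le_qsSum_of_clique_small {v e : ℕ} (h : 2 * qcK e + 2 ≤ v) :
    qcSum e ≤ qsSum v e := by
  have k1 := one_le_qcK e
  have s1 := choose_two_succ (qcK e)
  have s2 : (qcK e + 2).choose 2 = _ := choose_two_succ (qcK e + 1)
  have h1 : (qcK e + 1).choose 2 + (qcK e + 2).choose 2 ≤ v.choose 2 := by
    refine le_trans ?_ (Nat.choose_le_choose 2 h)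
    have : (((qcK e + 1).choose 2 : ℕ) : ℚ) + ((qcK e + 2).choose 2 : ℕ) ≤
        ((2 * qcK e + 2).choose 2 : ℕ) := by
      rw [cast_choose_two, cast_choose_two, cast_choose_two]
      push_cast
      have : (1 : ℚ) ≤ qcK e := by exact_mod_cast k1
      nlinarith
    exact_mod_cast this
  exact qcSum_le_qsSum_of_endpoints (by omega) (qcSum_choose_le_qsSum k1 (by omega))
    (qcSum_choose_le_qsSum (by omega) h1)

/-- The size of the largest complete graph having at most half of the edges of the complete graph
on `v` vertices. -/
def halfClique (v : ℕ) : ℕ := qcK (v.choose 2 / 2)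

theorem one_le_halfClique (v : ℕ) : 1 ≤ halfClique v := one_le_qcK _

theorem two_mul_choose_halfClique_le (v : ℕ) : 2 * (halfClique v).choose 2 ≤ v.choose 2 := by
  have := choose_qcK_le (v.choose 2 / 2)
  unfold halfClique; omega

theorem lt_two_mul_choose_halfClique_succ (v : ℕ) :
    v.choose 2 < 2 * (halfClique v + 1).choose 2 := by
  have := lt_choose_qcK_succ (v.choose 2 / 2)
  unfold halfClique; omega

theorem le_halfClique {v k : ℕ} (h : 2 * k.choose 2 ≤ v.choose 2) : k ≤ halfClique v :=
  le_qcK (by omega)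

theorem halfClique_le {v k : ℕ} (h : v.choose 2 < 2 * (k + 1).choose 2) : halfClique v ≤ k :=
  qcK_le (by omega)

theorem qcSum_choose_le_qsSum_of_lt_halfClique {v k : ℕ} (hk : 1 ≤ k) (h : k < halfClique v) :
    qcSum (k.choose 2) ≤ qsSum v (k.choose 2) := by
  have h1 := two_mul_choose_halfClique_le v
  have h2 := Nat.choose_le_choose 2 (show k + 1 ≤ halfClique v from h)
  have := choose_two_succ k
  exact qcSum_choose_le_qsSum hk (by omega)

/-- Up to half of all edges, the comparison of the two extremal graphs is decided by its single
instance at the largest complete graph in that range. -/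
theorem qcSum_le_qsSum_of_le_half {v e : ℕ} (he : 2 * e ≤ v.choose 2)
    (h : qcSum ((halfClique v).choose 2) ≤ qsSum v ((halfClique v).choose 2)) :
    qcSum e ≤ qsSum v e := by
  have hk : qcK e ≤ halfClique v := le_halfClique (by have := choose_qcK_le e; omega)
  have k1 := one_le_qcK e
  have hv := two_mul_choose_halfClique_le v
  rcases hk.lt_or_eq with hk | hk
  · have := Nat.choose_le_choose 2 (show qcK e + 1 ≤ halfClique v from hk)
    refine qcSum_le_qsSum_of_endpoints (by omega) (qcSum_choose_le_qsSum_of_lt_halfClique k1 hk) ?_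
    rcases (show qcK e + 1 ≤ halfClique v from hk).lt_or_eq with hk' | hk'
    · exact qcSum_choose_le_qsSum_of_lt_halfClique (by omega) hk'
    · rwa [hk']
  · rw [← hk] at h
    have a1 := choose_qcK_le e
    have a2 := lt_two_mul_choose_halfClique_succ v
    rw [← hk] at a2 hv
    rw [← sub_nonneg, qsSum_sub_qcSum (by omega)]
    set k := qcK e with hk
    have l1 := one_le_qcK (v.choose 2 - e)
    have b1 : 2 * (k.choose 2 : ℚ) ≤ v.choose 2 := by exact_mod_cast hv
    have b2 : (v.choose 2 : ℚ) ≤ 2 * ((k + 1).choose 2 : ℕ) := by exact_mod_cast a2.le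
    have b3 : 2 * (e : ℚ) ≤ v.choose 2 := by exact_mod_cast he
    rw [cast_choose_two] at b1 b2 b3
    rw [cast_choose_two] at b1 b2
    push_cast at b2
    refine gapPoly_nonneg_of_endpoints (a := (k.choose 2 : ℕ)) (b := v * (v - 1) / 4)
      (by exact_mod_cast a1) (by linarith)
      ((sub_nonneg.2 h).trans (qsSum_sub_qcSum_choose_le k1 l1 (by omega))) ?_
    -- At exactly half of the edges the two graphs are complements of each other.
    have key : gapPoly v k (qcK (v.choose 2 - e)) (v * (v - 1) / 4) =
        cliqueSum (qcK (v.choose 2 - e)) (v * (v - 1) / 4) - cliqueSum k (v * (v - 1) / 4) := by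
      unfold gapPoly cliqueSum; ring
    rw [key, sub_nonneg]
    exact cliqueSum_le k1 l1 (by linarith) (by linarith)

/-- The value of the comparison at the critical complete graph, when the complement has a clique of
the same size. -/
theorem qsSum_sub_qcSum_halfClique {v : ℕ}
    (h : v.choose 2 < (halfClique v).choose 2 + (halfClique v + 1).choose 2) :
    qsSum v ((halfClique v).choose 2) - qcSum ((halfClique v).choose 2) =
      (v.choose 2 - 2 * (halfClique v).choose 2) *
        (v.choose 2 - 2 * (halfClique v).choose 2 - (2 * v - 2 * halfClique v - 1)) := by
  have h1 := two_mul_choose_halfClique_le v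
  have k1 := one_le_halfClique v
  set k := halfClique v
  have hl : qcK (v.choose 2 - k.choose 2) = k :=
    le_antisymm (qcK_le (by omega)) (le_qcK (by omega))
  rw [qsSum_sub_qcSum (by omega), hl, qcK_choose k1, gapPoly, cast_choose_two, cast_choose_two]
  unfold cliqueSum; ring

/-! ### The Ahlswede–Katona theorem -/

open Finset

section Graph
open scoped Classical

variable {V : Type} [Fintype V]

/-- The sum of the squares of the degrees of a graph on an arbitrary finite vertex set. -/
noncomputable def degSq (G : SimpleGraph V) : ℤ := ∑ x, (G.degree x : ℤ) ^ 2

/-- The number of edges of a graph on an arbitrary finite vertex set. -/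
noncomputable def edgeCount (G : SimpleGraph V) : ℕ := G.edgeFinset.card

/-- The graph obtained by deleting the vertex `x`. -/
def deleteVertex (G : SimpleGraph V) (x : V) : SimpleGraph {y // y ≠ x} :=
  G.comap Subtype.val

theorem edgeCount_le (G : SimpleGraph V) : edgeCount G ≤ (Fintype.card V).choose 2 :=
  G.card_edgeFinset_le_card_choose_two

theorem degree_eq_sum_ite (G : SimpleGraph V) (x : V) :
    (G.degree x : ℤ) = ∑ y, if G.Adj x y then 1 else 0 := by
  rw [← G.card_neighborFinset_eq_degree, G.neighborFinset_eq_filter, Finset.card_filter]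
  push_cast
  rfl

theorem sum_degree_eq (G : SimpleGraph V) :
    ∑ x, (G.degree x : ℤ) = 2 * (edgeCount G : ℤ) := by
  exact_mod_cast G.sum_degrees_eq_twice_card_edges

/-- The graph obtained from `G` by replacing the edge `yz` by `xz`. -/
def switch (G : SimpleGraph V) (x y z : V) (hxz : x ≠ z) : SimpleGraph V where
  Adj a b := (G.Adj a b ∧ ¬(a = y ∧ b = z) ∧ ¬(a = z ∧ b = y)) ∨ (a = x ∧ b = z) ∨ (a = z ∧ b = x)
  symm := ⟨fun a b h => by
    rcases h with ⟨h, h'⟩ | h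
    · exact Or.inl ⟨h.symm, by tauto⟩
    · tauto⟩
  loopless := ⟨fun a h => by
    rcases h with ⟨h, -⟩ | ⟨h, h'⟩ | ⟨h, h'⟩
    · exact h.ne rfl
    · exact hxz (h.symm.trans h')
    · exact hxz (h'.symm.trans h)⟩

theorem degree_switch (G : SimpleGraph V) {x y z : V} (hxz : x ≠ z) (hxy : x ≠ y)
    (hyz : G.Adj y z) (h : ¬ G.Adj x z) (a : V) :
    ((switch G x y z hxz).degree a : ℤ) =
      G.degree a + (if a = x then 1 else 0) - (if a = y then 1 else 0) := by
  have hz : y ≠ z := hyz.ne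
  have key : ∀ b, (if (switch G x y z hxz).Adj a b then (1 : ℤ) else 0) =
      (if G.Adj a b then 1 else 0) + (if a = x then 1 else 0) * (if b = z then 1 else 0)
        + (if a = z then 1 else 0) * (if b = x then 1 else 0)
        - (if a = y then 1 else 0) * (if b = z then 1 else 0)
        - (if a = z then 1 else 0) * (if b = y then 1 else 0) := by
    intro b
    have hyz' := hyz.symm
    have hzx := hxz.symm
    have h' : ¬ G.Adj z x := fun h' => h h'.symm
    simp only [switch]
    by_cases a1 : a = x <;> by_cases a2 : a = y <;> by_cases a3 : a = z <;>
      by_cases b1 : b = x <;> by_cases b2 : b = y <;> by_cases b3 : b = z <;>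
      simp_all
  rw [degree_eq_sum_ite, degree_eq_sum_ite, Finset.sum_congr rfl fun b _ => key b]
  simp only [Finset.sum_sub_distrib, Finset.sum_add_distrib, ← Finset.mul_sum,
    Finset.sum_ite_eq', Finset.mem_univ, if_true]
  ring

theorem card_edgeFinset_switch (G : SimpleGraph V) {x y z : V} (hxz : x ≠ z) (hxy : x ≠ y)
    (hyz : G.Adj y z) (h : ¬ G.Adj x z) :
    edgeCount (switch G x y z hxz) = edgeCount G := by
  have h1 := sum_degree_eq (switch G x y z hxz)
  have h2 := sum_degree_eq G
  simp only [degree_switch G hxz hxy hyz h, Finset.sum_sub_distrib, Finset.sum_add_distrib,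
    Finset.sum_ite_eq', Finset.mem_univ, if_true] at h1
  omega

theorem degSq_switch (G : SimpleGraph V) {x y z : V} (hxz : x ≠ z) (hxy : x ≠ y)
    (hyz : G.Adj y z) (h : ¬ G.Adj x z) :
    degSq (switch G x y z hxz) = degSq G + 2 * (G.degree x - G.degree y) + 2 := by
  have key : ∀ a, ((switch G x y z hxz).degree a : ℤ) ^ 2 = (G.degree a : ℤ) ^ 2
      + (if a = x then 2 * (G.degree x : ℤ) + 1 else 0)
      - (if a = y then 2 * (G.degree y : ℤ) - 1 else 0) := by
    intro a
    rw [degree_switch G hxz hxy hyz h]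
    by_cases a1 : a = x
    · subst a1; simp [hxy]; ring
    · by_cases a2 : a = y
      · subst a2; simp [a1]; ring
      · simp [a1, a2]
  unfold degSq
  simp only [key, Finset.sum_sub_distrib, Finset.sum_add_distrib,
    Finset.sum_ite_eq', Finset.mem_univ, if_true]
  ring

/-- In a graph maximizing the sum of the squares of the degrees, neighbourhoods are nested in the
order of the degrees, since otherwise `switch` would increase the sum; these are the threshold
graphs. -/
theorem adj_of_maximal {G : SimpleGraph V}
    (hG : ∀ H : SimpleGraph V, edgeCount H = edgeCount G → degSq H ≤ degSq G)
    {x y z : V} (hd : G.degree y ≤ G.degree x) (hxz : x ≠ z) (hyz : G.Adj y z) : G.Adj x z := by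
  by_contra h
  have hxy : x ≠ y := by rintro rfl; exact h hyz
  have h1 := hG _ (card_edgeFinset_switch G hxz hxy hyz h)
  rw [degSq_switch G hxz hxy hyz h] at h1
  omega

theorem exists_dominating_or_isolated [Nonempty V] {G : SimpleGraph V}
    (hG : ∀ H : SimpleGraph V, edgeCount H = edgeCount G → degSq H ≤ degSq G) :
    ∃ x, (∀ y, y ≠ x → G.Adj x y) ∨ (∀ y, ¬ G.Adj x y) := by
  obtain ⟨x, hx⟩ := Finite.exists_max (fun a => G.degree a)
  obtain ⟨y, hy⟩ := Finite.exists_min (fun a => G.degree a)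
  by_cases hd : ∀ w, w ≠ x → G.Adj x w
  · exact ⟨x, Or.inl hd⟩
  push Not at hd
  obtain ⟨w, hwx, hw⟩ := hd
  refine ⟨y, Or.inr fun z hyz => hw ?_⟩
  by_cases hzw : z = w
  · subst hzw
    exact adj_of_maximal hG (hx y) hwx.symm hyz
  · have h1 : G.Adj w z := adj_of_maximal hG (hy w) (Ne.symm hzw) hyz
    exact adj_of_maximal hG (hx z) hwx.symm h1.symm

theorem degree_deleteVertex (G : SimpleGraph V) (x : V) (y : {y // y ≠ x}) :
    (G.degree y : ℤ) = (deleteVertex G x).degree y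
      + if G.Adj x y then 1 else 0 := by
  rw [degree_eq_sum_ite, degree_eq_sum_ite (deleteVertex G x),
    ← Fintype.sum_subtype_add_sum_subtype (fun z => z ≠ x)]
  congr 1
  have : Fintype.card {z : V // ¬ z ≠ x} = 1 := by simp
  rw [Fintype.sum_eq_single (⟨x, by simp⟩ : {z : V // ¬ z ≠ x})]
  · simp only [G.adj_comm]
  · rintro ⟨z, hz⟩ h
    simp at hz
    simp [hz] at h

theorem sum_ne_add (x : V) (f : V → ℤ) : ∑ y, f y = ∑ y : {y // y ≠ x}, f y + f x := by
  rw [← Fintype.sum_subtype_add_sum_subtype (fun z => z ≠ x)]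
  congr 1
  rw [Fintype.sum_eq_single (⟨x, by simp⟩ : {z : V // ¬ z ≠ x})]
  rintro ⟨z, hz⟩ h
  simp at hz
  simp [hz] at h

theorem deleteVertex_isolated {G : SimpleGraph V} {x : V} (hx : ∀ y, ¬ G.Adj x y) :
    edgeCount (deleteVertex G x) = edgeCount G ∧
    degSq (deleteVertex G x) = degSq G := by
  have h0 : (G.degree x : ℤ) = 0 := by rw [degree_eq_sum_ite]; simp [hx]
  have h1 := sum_degree_eq G
  have h2 := sum_degree_eq (deleteVertex G x)
  rw [sum_ne_add x] at h1
  simp only [degree_deleteVertex, h0, hx, if_false, add_zero] at h1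
  refine ⟨by omega, ?_⟩
  rw [degSq, degSq, sum_ne_add x]
  simp [degree_deleteVertex, h0, hx]

theorem deleteVertex_dominating {G : SimpleGraph V} {x : V} (hx : ∀ y, y ≠ x → G.Adj x y)
    {n : ℕ} (hn : Fintype.card V = n + 1) :
    edgeCount (deleteVertex G x) + n = edgeCount G ∧
    degSq G = degSq (deleteVertex G x) +
      4 * edgeCount (deleteVertex G x) + n * (n + 1) := by
  have hc : Fintype.card {y // y ≠ x} = n := by
    rw [Fintype.card_subtype_compl, hn]; simp
  have h0 : (G.degree x : ℤ) = n := by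
    rw [degree_eq_sum_ite, sum_ne_add x]
    simp only [fun y : {y // y ≠ x} => hx y y.2, if_true, G.irrefl, if_false]
    simp [hc]
  have hs := fun y : {y // y ≠ x} => degree_deleteVertex G x y
  simp only [fun y : {y // y ≠ x} => hx y y.2, if_true] at hs
  have h1 := sum_degree_eq G
  have h2 := sum_degree_eq (deleteVertex G x)
  rw [sum_ne_add x] at h1
  simp only [hs, h0, Finset.sum_add_distrib, Finset.sum_const, Finset.card_univ, hc,
    nsmul_eq_mul, mul_one] at h1
  refine ⟨by omega, ?_⟩
  rw [degSq, degSq, sum_ne_add x]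
  simp only [hs, h0, add_sq, Finset.sum_add_distrib, Finset.sum_const, Finset.card_univ, hc,
    nsmul_eq_mul, mul_one, ← Finset.mul_sum, h2]
  ring

/-- The Ahlswede–Katona theorem: one of the two quasi-graphs is extremal. -/
theorem degSq_le_max {n : ℕ} : ∀ {V : Type} [Fintype V] (_ : Fintype.card V = n)
    (G : SimpleGraph V),
    (degSq G : ℚ) ≤ max (qsSum n (edgeCount G)) (qcSum (edgeCount G)) := by
  induction n with
  | zero =>
    intro V _ hV G
    have := Fintype.card_eq_zero_iff.1 hV
    have h1 : edgeCount G = 0 := by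
      have := sum_degree_eq G
      simp at this; simpa using this
    have h2 : qcSum 0 = 0 := by simpa using qcSum_choose (k := 1) le_rfl
    refine le_max_of_le_right ?_
    rw [h1, h2]
    simp [degSq]
  | succ n ih =>
    intro V _ hV G₀
    have : Nonempty V := Fintype.card_pos_iff.1 (by omega)
    obtain ⟨G, hGmem, hGmax⟩ := Finset.exists_max_image
      (Finset.univ.filter fun H : SimpleGraph V => edgeCount H = edgeCount G₀)
      degSq ⟨G₀, by simp⟩
    simp only [Finset.mem_filter, Finset.mem_univ, true_and] at hGmem hGmax
    have hle : (degSq G₀ : ℚ) ≤ degSq G := by exact_mod_cast hGmax G₀ rfl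
    refine hle.trans ?_
    rw [← hGmem] at hGmax ⊢
    have hcard : ∀ x : V, Fintype.card {y // y ≠ x} = n := fun x => by
      rw [Fintype.card_subtype_compl, hV]; simp
    obtain ⟨x, hx | hx⟩ := exists_dominating_or_isolated hGmax
    · obtain ⟨h1, h2⟩ := deleteVertex_dominating hx hV
      have h3 := ih (hcard x) (deleteVertex G x)
      have h4 := edgeCount_le (deleteVertex G x)
      rw [hcard x] at h4
      have h2' : (degSq G : ℚ) = degSq (deleteVertex G x) +
        4 * edgeCount (deleteVertex G x) + n * (n + 1) := by
        exact_mod_cast h2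
      rw [← h1, h2', qsSum_succ_add]
      set e := edgeCount (deleteVertex G x)
      by_cases hn : n ≤ 2 * qcK e + 1
      · have h5 := qcSum_add_dominating_le h4 hn
        rcases le_max_iff.1 h3 with h | h
        · exact le_max_of_le_left (by linarith)
        · exact le_max_of_le_right (by linarith)
      · have h5 := qcSum_le_qsSum_of_clique_small (e := e) (v := n) (by omega)
        rw [max_eq_left h5] at h3
        exact le_max_of_le_left (by linarith)
    · obtain ⟨h1, h2⟩ := deleteVertex_isolated hx
      have h3 := ih (hcard x) (deleteVertex G x)
      have h4 := edgeCount_le (deleteVertex G x)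
      rw [hcard x, h1] at h4
      rw [h1, h2] at h3
      set e := edgeCount G
      by_cases hn : n ≤ 2 * qcK (n.choose 2 - e) + 1
      · exact h3.trans (max_le_max_right _ (qsSum_le_succ h4 hn))
      · have h5 := qsSum_compl h4 (qcSum_le_qsSum_of_clique_small (by omega))
        rw [max_eq_right h5] at h3
        exact le_max_of_le_right h3

end Graph

/-! ### Quasi-complete and quasi-star graphs -/

section QuasiGraphs
open scoped Classical

theorem sum_fin_ite_lt {v k : ℕ} (h : k ≤ v) (c : ℤ) :
    ∑ a : Fin v, (if a.val < k then c else 0) = k * c := by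
  rw [Fin.sum_univ_eq_sum_range (fun a => if a < k then c else 0) v, ← Finset.sum_filter]
  have : (Finset.range v).filter (· < k) = Finset.range k := by ext; simp; omega
  rw [this]; simp

theorem sum_fin_ite_eq (v k : ℕ) (c : ℤ) :
    ∑ a : Fin v, (if a.val = k then c else 0) = if k < v then c else 0 := by
  rw [Fin.sum_univ_eq_sum_range (fun a => if a = k then c else 0) v, Finset.sum_ite_eq']
  simp

/-- The parameters of the quasi-complete graph: `qcK e - qcJ e` is the number of edges outside the
clique, and an additional vertex is available unless this number is zero. -/
theorem qc_parameters {v e : ℕ} (he : e ≤ v.choose 2) (hv : 1 ≤ v) :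
    e = (qcK e).choose 2 + (qcK e - qcJ e) ∧ qcK e - qcJ e < qcK e ∧ qcK e ≤ v ∧
      (qcK e = v → qcK e - qcJ e = 0) := by
  have h := (qc_representation e _ _).2 ⟨rfl, rfl⟩
  have s := choose_two_succ (qcK e)
  have h1 : qcK e ≤ v := qcK_le (by rw [choose_two_succ]; omega)
  refine ⟨by omega, by omega, h1, fun h2 => ?_⟩
  rw [← h2] at he
  omega

theorem degree_QC {v e : ℕ} (he : e ≤ v.choose 2) (a : Fin v) :
    ((QC v e).degree a : ℤ) = (if a.val < qcK e then (qcK e : ℤ) - 1 else 0)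
      + (if a.val < qcK e - qcJ e then 1 else 0)
      + (if a.val = qcK e then ((qcK e - qcJ e : ℕ) : ℤ) else 0) := by
  have hv : 1 ≤ v := by have := a.2; omega
  obtain ⟨-, h2, h3, h4⟩ := qc_parameters he hv
  set k := qcK e with hk
  set r := k - qcJ e with hr
  have key : ∀ b : Fin v, (if (QC v e).Adj a b then (1 : ℤ) else 0) =
      (if a.val < k then 1 else 0) * (if b.val < k then 1 else 0)
      - (if a.val < k then 1 else 0) * (if b.val = a.val then 1 else 0)
      + (if a.val < r then 1 else 0) * (if b.val = k then 1 else 0)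
      + (if a.val = k then 1 else 0) * (if b.val < r then 1 else 0) := by
    intro b
    have : (QC v e).Adj a b ↔ a.val ≠ b.val ∧ ((a.val < k ∧ b.val < k) ∨
        (a.val < r ∧ b.val = k) ∨ (b.val < r ∧ a.val = k)) := by
      simp only [QC, ← hk, ← hr, ne_eq, Fin.ext_iff]
    rw [if_congr this rfl rfl]
    split_ifs <;> omega
  rw [degree_eq_sum_ite, Finset.sum_congr rfl fun b _ => key b]
  simp only [Finset.sum_sub_distrib, Finset.sum_add_distrib, ← Finset.mul_sum,
    sum_fin_ite_lt h3, sum_fin_ite_lt (h2.le.trans h3), sum_fin_ite_eq, a.2, if_true]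
  by_cases hkv : k < v
  · rw [if_pos hkv]; split_ifs <;> simp
  · rw [if_neg hkv, h4 (by omega)]
    split_ifs <;> omega

theorem edgeCount_QC {v e : ℕ} (he : e ≤ v.choose 2) : edgeCount (QC v e) = e := by
  rcases Nat.eq_zero_or_pos v with rfl | hv
  · have := edgeCount_le (QC 0 e)
    simp at this he; omega
  obtain ⟨h1, h2, h3, h4⟩ := qc_parameters he hv
  have hs := sum_degree_eq (QC v e)
  simp only [degree_QC he, Finset.sum_add_distrib, sum_fin_ite_lt h3,
    sum_fin_ite_lt (h2.le.trans h3), sum_fin_ite_eq] at hs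
  have hc : (2 * (qcK e).choose 2 : ℤ) = qcK e * (qcK e - 1) := by
    have := cast_choose_two (qcK e)
    have : (2 * (qcK e).choose 2 : ℚ) = qcK e * (qcK e - 1) := by rw [this]; ring
    exact_mod_cast this
  have hi : (if qcK e < v then ((qcK e - qcJ e : ℕ) : ℤ) else 0) = (qcK e - qcJ e : ℕ) := by
    split_ifs with h
    · rfl
    · rw [h4 (by omega)]; simp
  rw [hi, ← hc] at hs
  generalize qcK e - qcJ e = r at *
  omega

theorem degSq_QC {v e : ℕ} (he : e ≤ v.choose 2) : (degSq (QC v e) : ℚ) = qcSum e := by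
  rcases Nat.eq_zero_or_pos v with rfl | hv
  · have h2 : qcSum 0 = 0 := by simpa using qcSum_choose (k := 1) le_rfl
    have : e = 0 := by simpa using he
    subst this
    rw [h2]; simp [degSq]
  obtain ⟨h1, h2, h3, h4⟩ := qc_parameters he hv
  have key : ∀ a : Fin v, ((QC v e).degree a : ℤ) ^ 2 =
      (if a.val < qcK e then ((qcK e : ℤ) - 1) ^ 2 else 0)
      + (if a.val < qcK e - qcJ e then 2 * (qcK e : ℤ) - 1 else 0)
      + (if a.val = qcK e then ((qcK e - qcJ e : ℕ) : ℤ) ^ 2 else 0) := by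
    intro a
    rw [degree_QC he]
    split_ifs <;> first | omega | (simp; done) | ring
  have hi : (if qcK e < v then ((qcK e - qcJ e : ℕ) : ℤ) ^ 2 else 0) = (qcK e - qcJ e : ℕ) ^ 2 := by
    split_ifs with h
    · rfl
    · rw [h4 (by omega)]; simp
  rw [degSq, Finset.sum_congr rfl fun a _ => key a]
  simp only [Finset.sum_add_distrib, sum_fin_ite_lt h3,
    sum_fin_ite_lt (h2.le.trans h3), sum_fin_ite_eq]
  rw [hi, qcSum]
  have h1' : (e : ℚ) = qcK e * (qcK e - 1) / 2 + (qcK e - qcJ e : ℕ) := by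
    rw [← cast_choose_two]; exact_mod_cast h1
  generalize ((qcK e - qcJ e : ℕ)) = r at *
  push_cast
  unfold cliqueSum
  rw [h1']; ring

theorem degree_compl_cast {v : ℕ} {G H : SimpleGraph (Fin v)} (h : H = Gᶜ) (a : Fin v) :
    (H.degree a : ℤ) = v - 1 - G.degree a := by
  have h1 := G.degree_compl (v := a)
  have h2 := G.degree_lt_card_verts a
  rw [Fintype.card_fin] at h1 h2
  have h3 : H.degree a = v - 1 - G.degree a := by subst h; convert h1
  rw [h3]; omega

theorem edgeCount_compl {v : ℕ} {G H : SimpleGraph (Fin v)} (h : H = Gᶜ) :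
    edgeCount H + edgeCount G = v.choose 2 := by
  have h1 := sum_degree_eq G
  have h2 := sum_degree_eq H
  simp only [degree_compl_cast h, Finset.sum_sub_distrib, Finset.sum_const, Finset.card_univ,
    Fintype.card_fin, h1, nsmul_eq_mul] at h2
  have h3 : (2 * v.choose 2 : ℚ) = v * (v - 1) := by rw [cast_choose_two]; ring
  have h4 : (2 * v.choose 2 : ℤ) = v * (v - 1) := by exact_mod_cast h3
  have h5 : (2 * v.choose 2 : ℤ) = v * v - v * 1 := by rw [h4]; ring
  omega

theorem degSq_compl {v : ℕ} {G H : SimpleGraph (Fin v)} (h : H = Gᶜ) :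
    degSq H = v * (v - 1) ^ 2 - 4 * (v - 1) * edgeCount G + degSq G := by
  have h1 := sum_degree_eq G
  have key : ∀ a, (H.degree a : ℤ) ^ 2 =
      (v - 1) ^ 2 - 2 * (v - 1) * G.degree a + (G.degree a : ℤ) ^ 2 := by
    intro a; rw [degree_compl_cast h]; ring
  rw [degSq, Finset.sum_congr rfl fun a _ => key a]
  simp only [Finset.sum_add_distrib, Finset.sum_sub_distrib, Finset.sum_const, Finset.card_univ,
    Fintype.card_fin, nsmul_eq_mul, ← Finset.mul_sum, h1]
  unfold degSq edgeCount
  ring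

theorem cast_P2 {v : ℕ} (G : SimpleGraph (Fin v)) : (P2 G : ℤ) = degSq G := by
  simp [P2, degSq]

theorem P2_QC {v e : ℕ} (he : e ≤ v.choose 2) : (P2 (QC v e) : ℚ) = qcSum e := by
  rw [← degSq_QC he, ← cast_P2]; simp

theorem edgeCount_QS {v e : ℕ} (he : e ≤ v.choose 2) : edgeCount (QS v e) = e := by
  have h1 : edgeCount (QS v e) + _ = _ := edgeCount_compl rfl
  have h2 := edgeCount_QC (Nat.sub_le (v.choose 2) e)
  omega

theorem S_eq_qsSum {v e : ℕ} (he : e ≤ v.choose 2) : (S v e : ℚ) = qsSum v e := by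
  have h0 := Nat.sub_le (v.choose 2) e
  have h1 := cast_P2 (QS v e)
  rw [degSq_compl (H := QS v e) rfl, edgeCount_QC h0] at h1
  have h2 : (S v e : ℚ) = v * (v - 1) ^ 2 - 4 * (v - 1) * ((v.choose 2 - e : ℕ) : ℚ) +
      (degSq (QC v (v.choose 2 - e)) : ℚ) := by
    unfold S
    exact_mod_cast h1
  rw [h2, degSq_QC h0, qsSum, Nat.cast_sub he]

theorem maxP2_le_iff {v e N : ℕ} :
    maxP2 v e ≤ N ↔ ∀ G : SimpleGraph (Fin v), edgeCount G = e → P2 G ≤ N := by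
  simp only [maxP2, Finset.sup_le_iff, Finset.mem_filter, Finset.mem_univ, true_and]
  simp only [edgeCount]

/-- The quasi-star graph is extremal exactly when it is at least as good as the quasi-complete
graph. -/
theorem maxP2_eq_S_iff {v e : ℕ} (he : e ≤ v.choose 2) :
    maxP2 v e = S v e ↔ qcSum e ≤ qsSum v e := by
  have hS : S v e ≤ maxP2 v e := maxP2_le_iff.1 le_rfl _ (edgeCount_QS he)
  constructor
  · intro h
    have h1 := maxP2_le_iff.1 h.le _ (edgeCount_QC he)
    rw [← P2_QC he, ← S_eq_qsSum he]
    exact_mod_cast h1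
  · intro h
    refine le_antisymm (maxP2_le_iff.2 fun G hG => ?_) hS
    have h1 := degSq_le_max (Fintype.card_fin v) G
    rw [hG, max_eq_left h, ← S_eq_qsSum he, ← cast_P2] at h1
    exact_mod_cast h1

/-- Extremality of the quasi-star graphs up to half of all edges is decided at the critical
complete graph. -/
theorem forall_maxP2_eq_S_iff (v : ℕ) :
    (∀ e : ℕ, (e : ℚ) ≤ m v → maxP2 v e = S v e) ↔
      qcSum ((halfClique v).choose 2) ≤ qsSum v ((halfClique v).choose 2) := by
  have hm : ∀ e : ℕ, (e : ℚ) ≤ m v ↔ 2 * e ≤ v.choose 2 := by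
    intro e
    rw [m, le_div_iff₀ (by norm_num), mul_comm]
    exact_mod_cast Iff.rfl
  have hc := two_mul_choose_halfClique_le v
  constructor
  · intro h
    exact (maxP2_eq_S_iff (by omega)).1 (h _ ((hm _).2 hc))
  · intro h e he
    rw [hm] at he
    exact (maxP2_eq_S_iff (by omega)).2 (qcSum_le_qsSum_of_le_half he h)

end QuasiGraphs

/-! ### Counting by telescoping -/

theorem halfClique_le_self {v : ℕ} (hv : 1 ≤ v) : halfClique v ≤ v :=
  halfClique_le (by rw [choose_two_succ]; omega)

theorem halfClique_add_two_bounds {v : ℕ} (hv : 1 ≤ v) :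
    halfClique v + 1 ≤ halfClique (v + 2) ∧ halfClique (v + 2) ≤ halfClique v + 2 := by
  have h1 := two_mul_choose_halfClique_le v
  have h2 := lt_two_mul_choose_halfClique_succ v
  have h3 := halfClique_le_self hv
  set k := halfClique v
  have s1 := choose_two_succ v
  have s2 : (v + 2).choose 2 = _ := choose_two_succ (v + 1)
  have s3 := choose_two_succ k
  have s4 : (k + 2).choose 2 = _ := choose_two_succ (k + 1)
  have s5 : (k + 2 + 1).choose 2 = _ := choose_two_succ (k + 2)
  refine ⟨le_halfClique (by omega), halfClique_le ?_⟩
  have : v ≤ 2 * k + 2 := by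
    by_contra! h
    have h2' : ((v.choose 2 : ℕ) : ℚ) < 2 * ((k + 1).choose 2 : ℕ) := by exact_mod_cast h2
    rw [cast_choose_two, cast_choose_two] at h2'
    push_cast at h2'
    have h' : (2 * k + 3 : ℚ) ≤ v := by exact_mod_cast h
    have : (0 : ℚ) ≤ k := by positivity
    nlinarith
  omega

/-- The vertex numbers for which a complete graph has exactly half of all possible edges. -/
def HalfExact (v : ℕ) : Prop := 2 * (halfClique v).choose 2 = v.choose 2

/-- The comparison at the critical complete graph is decided by the increments of `halfClique`. -/
theorem qcSum_le_qsSum_halfClique_iff {v : ℕ} (hv : 2 ≤ v) :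
    qcSum ((halfClique (v + 2)).choose 2) ≤ qsSum (v + 2) ((halfClique (v + 2)).choose 2) ↔
      HalfExact (v + 2) ∨ halfClique (v + 2) = halfClique v + 1 := by
  obtain ⟨b1, b2⟩ := halfClique_add_two_bounds (show 1 ≤ v by omega)
  have h1 := two_mul_choose_halfClique_le (v + 2)
  have h2 := lt_two_mul_choose_halfClique_succ (v + 2)
  have g2 := lt_two_mul_choose_halfClique_succ v
  have hd := qsSum_sub_qcSum_halfClique (v := v + 2)
  unfold HalfExact
  have k1 := one_le_halfClique v
  set k := halfClique (v + 2)
  set l := halfClique v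
  have s1 := choose_two_succ v
  have s2 : (v + 2).choose 2 = _ := choose_two_succ (v + 1)
  have s3 := choose_two_succ k
  obtain ⟨k', hk'⟩ : ∃ k', k = k' + 1 := ⟨k - 1, by omega⟩
  have s4 : k.choose 2 = k'.choose 2 + k' := by rw [hk', choose_two_succ]
  have hkl : k = l + 1 ↔ 2 * v + 3 + 2 * k.choose 2 ≤ (v + 2).choose 2 + 2 * k := by
    constructor
    · intro h
      have h4 := two_mul_choose_halfClique_le v
      have : k' = l := by omega
      rw [this] at s4
      change 2 * l.choose 2 ≤ v.choose 2 at h4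
      omega
    · intro h
      have : k' ≤ l := le_halfClique (by omega)
      omega
  by_cases h3 : (v + 2).choose 2 < k.choose 2 + (k + 1).choose 2
  · rw [← sub_nonneg, hd h3, hkl]
    obtain ⟨i, hi⟩ : ∃ i, (v + 2).choose 2 = 2 * k.choose 2 + i :=
      ⟨(v + 2).choose 2 - 2 * k.choose 2, by omega⟩
    have hi' : (((v + 2).choose 2 : ℕ) : ℚ) = 2 * k.choose 2 + i := by exact_mod_cast hi
    rw [hi', hi, add_sub_cancel_left]
    have e1 : (i : ℚ) - (2 * ((v + 2 : ℕ) : ℚ) - 2 * k - 1) = (i + 2 * k : ℕ) - (2 * v + 3 : ℕ) := by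
      push_cast; ring
    rw [e1]
    rcases Nat.eq_zero_or_pos i with rfl | hpos
    · simp
    · rw [mul_nonneg_iff_of_pos_left (by exact_mod_cast hpos), sub_nonneg, Nat.cast_le]
      omega
  -- If the clique of the complement is larger than `k`, both sides hold.
  · refine iff_of_true (qcSum_choose_le_qsSum (one_le_halfClique _) (not_lt.1 h3)) (Or.inr ?_)
    rw [hkl]
    -- The clique comprises more than two thirds of the vertices, as `1 / √2 > 2 / 3`.
    have : 2 * v + 3 ≤ 3 * k := by
      by_contra! h
      have h2' : (((v + 2).choose 2 : ℕ) : ℚ) < 2 * ((k + 1).choose 2 : ℕ) := by exact_mod_cast h2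
      rw [cast_choose_two, cast_choose_two] at h2'
      push_cast at h2'
      have h' : (3 * k + 1 : ℚ) ≤ 2 * v + 3 := by exact_mod_cast h
      have : (0 : ℚ) ≤ k := by positivity
      have : (2 : ℚ) ≤ v := by exact_mod_cast hv
      nlinarith
    omega

/-- Successive elements of `HalfExact` at least double: for such `u`, the numbers `2 * u - 1` and
`2 * halfClique u - 1` solve the Pell equation `x ^ 2 - 2 * y ^ 2 = -1`. -/
theorem HalfExact.two_mul_le {v w : ℕ} (hv : HalfExact v) (hw : HalfExact w) (h1 : 1 ≤ v)
    (hvw : v < w) : 2 * v ≤ w := by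
  have pell : ∀ {u : ℕ}, HalfExact u →
      2 * (2 * (halfClique u : ℤ) - 1) ^ 2 = (2 * (u : ℤ) - 1) ^ 2 + 1 := by
    intro u hu
    have hu' : (2 * (halfClique u).choose 2 : ℚ) = u.choose 2 := by exact_mod_cast hu
    rw [cast_choose_two, cast_choose_two] at hu'
    have : 2 * (2 * (halfClique u : ℚ) - 1) ^ 2 = (2 * (u : ℚ) - 1) ^ 2 + 1 := by
      linear_combination 8 * hu'
    exact_mod_cast this
  have p1 := pell hv
  have p2 := pell hw
  have y1 : (1 : ℤ) ≤ 2 * halfClique v - 1 := by have := one_le_halfClique v; omega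
  have y2 : (1 : ℤ) ≤ 2 * halfClique w - 1 := by have := one_le_halfClique w; omega
  have x1 : (1 : ℤ) ≤ 2 * v - 1 := by omega
  have x2 : (2 * v - 1 : ℤ) < 2 * w - 1 := by omega
  suffices (2 * (2 * v - 1) : ℤ) < 2 * w - 1 by omega
  generalize (2 * halfClique v - 1 : ℤ) = y at *
  generalize (2 * halfClique w - 1 : ℤ) = z at *
  generalize (2 * v - 1 : ℤ) = x at *
  generalize (2 * w - 1 : ℤ) = u at *
  have c1 : x ≤ 2 * y := by nlinarith
  have c2 : u ≤ 2 * z := by nlinarith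
  -- The determinant `u * y - x * z` of the two solutions is a positive integer.
  have key : 2 * ((u * y - x * z) * (u * y + x * z)) = u ^ 2 - x ^ 2 := by
    linear_combination u ^ 2 * p1 - x ^ 2 * p2
  have pos : 0 < u * y + x * z := by nlinarith
  have d : 1 ≤ u * y - x * z := by
    have : 0 < (u * y - x * z) * (u * y + x * z) := by nlinarith
    exact (pos_iff_pos_of_mul_pos this).2 pos
  have e1 : 2 * (u * y + x * z) ≤ u ^ 2 - x ^ 2 := by nlinarith
  have e2 : u * x ≤ 2 * (u * y) := by nlinarith
  have e3 : x * u ≤ 2 * (x * z) := by nlinarith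
  by_contra! h
  nlinarith

open scoped Classical in
/-- The number of `v` in `[1, t]` with the property `p`. -/
noncomputable def countUpTo (p : ℕ → Prop) (t : ℕ) : ℕ := ((Icc 1 t).filter p).card

open scoped Classical in
theorem countUpTo_succ (p : ℕ → Prop) (t : ℕ) :
    countUpTo p (t + 1) = countUpTo p t + if p (t + 1) then 1 else 0 := by
  simp only [countUpTo, Finset.card_filter]
  rw [Finset.sum_Icc_succ_top (by omega)]

theorem countUpTo_halfExact_le (t : ℕ) : countUpTo HalfExact t ≤ Nat.log 2 t + 1 := by
  classical
  rw [← Finset.card_range (Nat.log 2 t + 1)]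
  refine Finset.card_le_card_of_injOn (Nat.log 2) ?_ ?_
  · intro v hv
    simp only [coe_filter, mem_Icc, Set.mem_ofPred_eq] at hv
    have := Nat.log_mono_right (b := 2) hv.1.2
    simp only [coe_range, Set.mem_Iio]
    omega
  · have key : ∀ v w, HalfExact v → HalfExact w → 1 ≤ v → v < w → Nat.log 2 v < Nat.log 2 w := by
      intro v w hv hw h1 hvw
      have h2 := Nat.log_mono_right (b := 2) (hv.two_mul_le hw h1 hvw)
      rw [mul_comm, Nat.log_mul_base (by norm_num) (by omega)] at h2
      omega
    intro v hv w hw h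
    simp only [coe_filter, mem_Icc, Set.mem_ofPred_eq] at hv hw
    rcases lt_trichotomy v w with hlt | heq | hgt
    · exact absurd h (key v w hv.2 hw.2 hv.1.1 hlt).ne
    · exact heq
    · exact absurd h.symm (key w v hw.2 hv.2 hw.1.1 hgt).ne

theorem n_eq_countUpTo (t : ℕ) :
    n t = countUpTo (fun v => qcSum ((halfClique v).choose 2) ≤
      qsSum v ((halfClique v).choose 2)) t := by
  classical
  rw [n, countUpTo, ← Set.ncard_coe_finset]
  congr 1
  ext v
  simp [forall_maxP2_eq_S_iff]

/-- The counting function in terms of `halfClique`, by telescoping: outside of `HalfExact`, the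
number `v + 2` is counted exactly when `halfClique` increases by `1`, and not by `2`, from `v` to
`v + 2`. The initial value `d 2` only contributes a constant. -/
theorem n_telescope (t : ℕ) (ht : 2 ≤ t) :
    let d : ℕ → ℤ := fun t => n (t + 1) - 2 * t + halfClique (t + 1) + halfClique t
    d 2 ≤ d t ∧ d t ≤ d 2 + countUpTo HalfExact (t + 1) := by
  classical
  intro d
  induction t, ht using Nat.le_induction with
  | base => exact ⟨le_rfl, by omega⟩
  | succ t ht ih =>
    have h1 := n_eq_countUpTo (t + 1)
    have h2 := n_eq_countUpTo (t + 1 + 1)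
    have h3 := countUpTo_succ HalfExact (t + 1)
    rw [countUpTo_succ, ← h1] at h2
    have h4 := qcSum_le_qsSum_halfClique_iff ht
    obtain ⟨b1, b2⟩ := halfClique_add_two_bounds (show 1 ≤ t by omega)
    simp only [show t + 1 + 1 = t + 2 from rfl] at h2 h3
    have hd : d (t + 1) = d t + (n (t + 2) - n (t + 1) : ℤ) - 2 + halfClique (t + 2)
        - halfClique t := by
      simp only [d]; push_cast; ring
    rw [if_congr h4 rfl rfl] at h2
    simp only [show t + 1 + 1 = t + 2 from rfl]
    by_cases p : HalfExact (t + 2) <;> by_cases q : halfClique (t + 2) = halfClique t + 1 <;>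
      simp only [p, q, true_or, false_or, if_true, if_false] at h2 h3 <;> omega

theorem abs_halfClique_sub_le (t : ℕ) (ht : 1 ≤ t) :
    |(halfClique t : ℝ) - t * √2 / 2| ≤ 2 := by
  have h1 : ((2 * (halfClique t).choose 2 : ℕ) : ℝ) ≤ (t.choose 2 : ℕ) := by
    exact_mod_cast two_mul_choose_halfClique_le t
  have h2 : ((t.choose 2 : ℕ) : ℝ) < (2 * (halfClique t + 1).choose 2 : ℕ) := by
    exact_mod_cast lt_two_mul_choose_halfClique_succ t
  push_cast [Nat.cast_choose_two] at h1 h2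
  have h3 : (1 : ℝ) ≤ t := by exact_mod_cast ht
  have h4 : (1 : ℝ) ≤ halfClique t := by exact_mod_cast one_le_halfClique t
  have h5 : √2 ^ 2 = (2 : ℝ) := Real.sq_sqrt (by norm_num)
  have h6 : (1 : ℝ) ≤ √2 := Real.one_le_sqrt.2 (by norm_num)
  set k : ℝ := (halfClique t : ℝ)
  have h7 : (t * √2 / 2) ^ 2 = (t : ℝ) ^ 2 / 2 := by rw [div_pow, mul_pow, h5]; ring
  have h8 : (t : ℝ) ≤ 2 * (t * √2 / 2) := by nlinarith
  set x : ℝ := t * √2 / 2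
  rw [abs_le]
  constructor
  · by_contra! h
    nlinarith
  · by_contra! h
    nlinarith

end DegreeSquares

theorem corollary2p8 :
    Filter.Tendsto (fun t : ℕ => (DegreeSquares.n t : ℝ) / (t : ℝ)) Filter.atTop
      (nhds (2 - Real.sqrt 2)) := by
  -- The vertex numbers in `HalfExact` account for the logarithm in the error term.
  obtain ⟨C, hC⟩ : ∃ C : ℝ, ∀ t : ℕ, 3 ≤ t →
      |(DegreeSquares.n t : ℝ) - t * (2 - √2)| ≤ C + Real.logb 2 t := by
    set D : ℤ := DegreeSquares.n (2 + 1) - 2 * (2 : ℕ) + DegreeSquares.halfClique (2 + 1) +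
      DegreeSquares.halfClique 2 with hD
    refine ⟨|(D : ℝ)| + 9, fun t ht => ?_⟩
    obtain ⟨s, rfl⟩ : ∃ s, t = s + 1 := ⟨t - 1, by omega⟩
    obtain ⟨h1, h2⟩ := DegreeSquares.n_telescope s (by omega)
    have h3 : (DegreeSquares.countUpTo DegreeSquares.HalfExact (s + 1) : ℝ) ≤
        Nat.log 2 (s + 1) + 1 := by
      exact_mod_cast DegreeSquares.countUpTo_halfExact_le (s + 1)
    have h4 : (Nat.log 2 (s + 1) : ℝ) ≤ Real.logb 2 ((s + 1 : ℕ) : ℝ) := by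
      exact_mod_cast Real.natLog_le_logb (s + 1) 2
    have h4' : (0 : ℝ) ≤ Nat.log 2 (s + 1) := by positivity
    have h5 := abs_le.1 (DegreeSquares.abs_halfClique_sub_le s (by omega))
    have h6 := abs_le.1 (DegreeSquares.abs_halfClique_sub_le (s + 1) (by omega))
    simp only [← hD] at h1 h2
    have h1' : (D : ℝ) ≤ DegreeSquares.n (s + 1) - 2 * s + DegreeSquares.halfClique (s + 1) +
      DegreeSquares.halfClique s := by exact_mod_cast h1
    have h2' : (DegreeSquares.n (s + 1) - 2 * s + DegreeSquares.halfClique (s + 1) +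
      DegreeSquares.halfClique s : ℝ) ≤
        D + DegreeSquares.countUpTo DegreeSquares.HalfExact (s + 1) := by
      exact_mod_cast h2
    have h7 := neg_abs_le (D : ℝ)
    have h8 := le_abs_self (D : ℝ)
    have h9 : (1 : ℝ) ≤ √2 := Real.one_le_sqrt.2 (by norm_num)
    have h10 : √2 ≤ (2 : ℝ) := Real.sqrt_le_iff.2 (by norm_num)
    push_cast at h6 ⊢
    push_cast at h4
    rw [abs_le]
    constructor <;> nlinarith
  have hlim : Filter.Tendsto (fun t : ℕ => (C + Real.logb 2 t) / (t : ℝ)) Filter.atTop (nhds 0) := by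
    have a1 : Filter.Tendsto (fun t : ℕ => Real.log t / (t : ℝ)) Filter.atTop (nhds 0) :=
      (Real.isLittleO_log_id_atTop.tendsto_div_nhds_zero).comp tendsto_natCast_atTop_atTop
    have a2 := (tendsto_const_div_atTop_nhds_zero_nat C).add (a1.div_const (Real.log 2))
    simp only [zero_div, add_zero] at a2
    refine a2.congr fun t => ?_
    rw [Real.logb]; ring
  rw [tendsto_iff_dist_tendsto_zero]
  refine squeeze_zero' (Filter.Eventually.of_forall fun _ => dist_nonneg) ?_ hlim
  filter_upwards [Filter.eventually_ge_atTop 3] with t ht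
  have tpos : (0 : ℝ) < t := by exact_mod_cast (by omega : 0 < t)
  have e1 : (DegreeSquares.n t : ℝ) / t - (2 - √2) =
      ((DegreeSquares.n t : ℝ) - t * (2 - √2)) / t := by
    field_simp
  rw [Real.dist_eq, e1, abs_div, abs_of_pos tpos]
  exact div_le_div_of_nonneg_right (hC t ht) tpos.le
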